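/- Let $R$ be an associative ring with identity that is von Neumann regular (for every $a\in R$ there is $b\in R$ with $aba=a$). Then the following conditions are equivalent: 1) Every right $R$-module $M$ is an $I_0$-module, that is, every submodule of $M$ that is not small in $M$ contains a nonzero direct summand of $M$ (a submodule $N$ of $M$ is small if $N+X=M$ implies $X=M$ for every submodule $X$ of $M$). 2) $R$ is a right $SV$-ring, that is, the right module $R_R$ is semiartinian and is a $V$-module. Here a module $M$ is semiartinian if $\operatorname{Soc}_\alpha(M)=M$ for some ordinal $\alpha$, where $\operatorname{Soc}_0(M)=0$, $\operatorname{Soc}_{\alpha+1}(M)/\operatorname{Soc}_\alpha(M)$ is the socle (the sum of all simple submodules) of $M/\operatorname{Soc}_\alpha(M)$, and $\operatorname{Soc}_\alpha(M)=\bigcup_{\beta<\alpha}\operatorname{Soc}_\beta(M)$ for limit ordinals $\alpha$; and $M$ is a $V$-module if every proper submodule of $M$ is an intersection of maximal submodules of $M$. 3) Every right $R$-module is almost projective. 4) Every simple right $R$-module is almost projective. Here a right $R$-module $M$ is almost projective if for every right $R$-module $N$, every submodule $K$ of $N$ with natural homomorphism $g:N\to N/K$, and every homomorphism $f:M\to N/K$,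 either there is a homomorphism $h:M\to N$ with $f=gh$, or there are a nonzero direct summand $N'$ of $N$ and a homomorphism $h':N'\to M$ with $g\iota=fh'$, where $\iota:N'\to N$ is the inclusion. -/

import Mathlib

universe u v

/-- A ring is von Neumann regular if every element `a` satisfies `a = a * b * a` for some `b`. -/
def IsVonNeumannRegularRing (R : Type u) [Ring R] : Prop :=
  ∀ a : R, ∃ b : R, a * b * a = a

namespace Module

section

variable (A : Type u) [Ring A] (M : Type v) [AddCommGroup M] [Module A M]

/-- `N` is a small (superfluous) submodule: `N + X = M` implies `X = M`. -/
def IsSmallSubmodule {A : Type u} [Ring A] {M : Type v} [AddCommGroup M] [Module A M]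
    (N : Submodule A M) : Prop :=
  ∀ X : Submodule A M, N ⊔ X = ⊤ → X = ⊤

/-- `N` is a direct summand: it has a complementary submodule. -/
def IsDirectSummand {A : Type u} [Ring A] {M : Type v} [AddCommGroup M] [Module A M]
    (N : Submodule A M) : Prop :=
  ∃ C : Submodule A M, IsCompl N C

/-- `M` is an `I₀`-module: every nonsmall submodule contains a nonzero direct summand of `M`. -/
def IsI0Module : Prop :=
  ∀ N : Submodule A M, ¬ IsSmallSubmodule N →
    ∃ D : Submodule A M, D ≤ N ∧ D ≠ ⊥ ∧ IsDirectSummand D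

/-- `M` is almost `N`-projective: for every submodule `K` of `N` with natural map
`g : N → N / K` and every `f : M → N / K`, either `f` lifts along `g`, or there are a nonzero
direct summand `N'` of `N` and `h' : N' → M` such that `g` restricted to `N'` is `f ∘ h'`. -/
def IsAlmostProjectiveTo (N : Type v) [AddCommGroup N] [Module A N] : Prop :=
  ∀ (K : Submodule A N) (f : M →ₗ[A] N ⧸ K),
    (∃ h : M →ₗ[A] N, f = K.mkQ ∘ₗ h) ∨
      ∃ N' : Submodule A N, N' ≠ ⊥ ∧ IsDirectSummand N' ∧
        ∃ h' : N' →ₗ[A] M, K.mkQ ∘ₗ N'.subtype = f ∘ₗ h'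

/-- `M` is almost projective: almost `N`-projective for every module `N`. -/
def IsAlmostProjective : Prop :=
  ∀ (N : Type v) [AddCommGroup N] [Module A N], IsAlmostProjectiveTo A M N

/-- The socle: the sum of all simple submodules. -/
def socle : Submodule A M :=
  sSup {S : Submodule A M | IsSimpleModule A S}

/-- The Loewy series: `Soc₀ = 0`, `Soc_{α+1} / Soc_α = Soc (M / Soc_α)`, and unions at limit
ordinals (the supremum of a chain of submodules is its union). -/
noncomputable def loewySeries (α : Ordinal.{v}) : Submodule A M :=
  Ordinal.limitRecOn (motive := fun _ => Submodule A M) α ⊥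
    (fun _ S => (socle A (M ⧸ S)).comap S.mkQ)
    (fun β _ S => ⨆ γ : Set.Iio β, S γ.1 γ.2)

/-- `M` is semiartinian: its Loewy series reaches `M`. -/
def IsSemiartinian : Prop :=
  ∃ α : Ordinal.{v}, loewySeries A M α = ⊤

/-- `M` is a `V`-module: every proper submodule is an intersection of maximal submodules. -/
def IsVModule : Prop :=
  ∀ N : Submodule A M, N ≠ ⊤ → ∃ s : Set (Submodule A M), (∀ P ∈ s, IsCoatom P) ∧ sInf s = N

end

end Module

/-- `R` is a right `SV`-ring: the right module `R_R` (that is, `R` as a module over the opposite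
ring) is semiartinian and a `V`-module. -/
def IsRightSVRing (R : Type u) [Ring R] : Prop :=
  Module.IsSemiartinian Rᵐᵒᵖ R ∧ Module.IsVModule Rᵐᵒᵖ R

/-! Put `A = Rᵐᵒᵖ`, so that right `R`-modules are left `A`-modules. Over a right SV-ring every
nonzero module has a simple submodule and simple modules are injective, so every nonzero submodule
contains a nonzero direct summand; 1) and 3) follow at once.

Conversely, 1) and 4) each imply `FiniteSemisimpleOrInjective`, from which
`isSemiartinian_and_isVModule` recovers 2). The core is a diagonal argument in the style of Osofsky,
`not_injective_quotient_of_iSupIndep`. It forces nonzero finitely generated regular quasi-projective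
modules to have simple submodules (`IsRegularModule.exists_simple`). Quotients of the ring by fully
invariant submodules, such as the Loewy terms, are of this kind, so the ring is semiartinian.

For the `V` property, a noninjective simple module `S` yields a non-Noetherian cyclic submodule of
`ℕ → S`. That submodule contains a nonzero injective module, and `S` is a retract of it, a
contradiction. -/

namespace Module

/-! ### Direct summands, injective modules, and the consequence of condition 4) -/

section Generalities

variable {A : Type u} [Ring A] {M N P : Type u} [AddCommGroup M] [Module A M]
  [AddCommGroup N] [Module A N] [AddCommGroup P] [Module A P]

theorem isDirectSummand_iff_exists_projection {N : Submodule A M} :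
    IsDirectSummand N ↔ ∃ p : M →ₗ[A] M, (∀ x, p x ∈ N) ∧ ∀ x ∈ N, p x = x := by
  constructor
  · rintro ⟨C, hC⟩
    refine ⟨N.subtype ∘ₗ N.projectionOnto C hC, fun x => by simp, fun x hx => ?_⟩
    exact congrArg Subtype.val (Submodule.projectionOnto_apply_left hC ⟨x, hx⟩)
  · rintro ⟨p, hp, hp'⟩
    refine ⟨LinearMap.ker p, ?_, ?_⟩
    · rw [Submodule.disjoint_def]
      intro x hx hk
      rw [← hp' x hx]
      exact hk
    · rw [codisjoint_iff, eq_top_iff]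
      intro x _
      refine Submodule.mem_sup.2 ⟨p x, hp x, x - p x, ?_, by abel⟩
      simp [hp' _ (hp x)]

theorem IsDirectSummand.exists_retraction {N : Submodule A M} (h : IsDirectSummand N) :
    ∃ r : M →ₗ[A] N, ∀ x : N, r x = x := by
  obtain ⟨p, hp, hp'⟩ := isDirectSummand_iff_exists_projection.1 h
  exact ⟨p.codRestrict N hp, fun x => Subtype.ext (hp' x x.2)⟩

theorem IsDirectSummand.finite [Module.Finite A M] {N : Submodule A M}
    (h : IsDirectSummand N) : Module.Finite A N := by
  obtain ⟨r, hr⟩ := h.exists_retraction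
  exact Module.Finite.of_surjective r fun x => ⟨x, hr x⟩

theorem Injective.of_retract [Module.Injective A M] (i : N →ₗ[A] M) (r : M →ₗ[A] N)
    (h : ∀ x, r (i x) = x) : Module.Injective A N := by
  refine ⟨fun X Y _ _ _ _ f hf g => ?_⟩
  obtain ⟨k, hk⟩ := Module.Injective.out f hf (i ∘ₗ g)
  exact ⟨r ∘ₗ k, fun x => by simp [hk, h]⟩

theorem Injective.of_linearEquiv [Module.Injective A M] (e : M ≃ₗ[A] N) :
    Module.Injective A N :=
  Injective.of_retract (M := M) e.symm.toLinearMap e.toLinearMap (by simp)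

theorem Injective.of_isDirectSummand [Module.Injective A M] {N : Submodule A M}
    (h : IsDirectSummand N) : Module.Injective A N := by
  obtain ⟨r, hr⟩ := h.exists_retraction
  exact Injective.of_retract N.subtype r hr

theorem Injective.isDirectSummand {N : Submodule A M} [Module.Injective A N] :
    IsDirectSummand N := by
  obtain ⟨r, hr⟩ := Module.Injective.out N.subtype N.injective_subtype (LinearMap.id)
  exact isDirectSummand_iff_exists_projection.2 ⟨N.subtype ∘ₗ r, fun x => (r x).2,
    fun x hx => congrArg Subtype.val (hr ⟨x, hx⟩)⟩

theorem Injective.exists_submodule_of_le_range {i : M →ₗ[A] N} (hi : Function.Injective i)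
    {D : Submodule A N} (hle : D ≤ LinearMap.range i) (hD : D ≠ ⊥) [Module.Injective A D] :
    ∃ D' : Submodule A M, D' ≠ ⊥ ∧ Module.Injective A D' := by
  have hmap : (D.comap i).map i = D := by rw [Submodule.map_comap_eq, inf_eq_right.2 hle]
  refine ⟨D.comap i, fun h0 => hD (by rw [← hmap, h0, Submodule.map_bot]), ?_⟩
  let e : D.comap i ≃ₗ[A] D :=
    (Submodule.equivMapOfInjective i hi (D.comap i)).trans (LinearEquiv.ofEq _ _ hmap)
  exact Injective.of_linearEquiv e.symm

/-- A linear map into an injective module can be prescribed on a submodule `X` and made to vanish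
on a submodule disjoint from `X`. -/
theorem Injective.exists_extension_vanishing [Module.Injective A N] {X Y : Submodule A M}
    (h : Disjoint X Y) (g : X →ₗ[A] N) :
    ∃ k : M →ₗ[A] N, (∀ x : X, k x = g x) ∧ ∀ y ∈ Y, k y = 0 := by
  have hinj : Function.Injective (Y.mkQ ∘ₗ X.subtype) := by
    rw [← LinearMap.ker_eq_bot, eq_bot_iff]
    intro x hx
    have hxY : (x : M) ∈ Y := by simpa using hx
    exact Subtype.ext (Submodule.disjoint_def.1 h x x.2 hxY)
  obtain ⟨k, hk⟩ := Module.Injective.out _ hinj g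
  refine ⟨k ∘ₗ Y.mkQ, hk, fun y hy => ?_⟩
  have : Y.mkQ y = 0 := by simpa using hy
  rw [LinearMap.comp_apply, this, map_zero]

theorem exists_maximal_disjoint (X Y₀ : Submodule A M) (h : Disjoint X Y₀) :
    ∃ Y, Y₀ ≤ Y ∧ Disjoint X Y ∧ ∀ Z, Y ≤ Z → Disjoint X Z → Z = Y := by
  obtain ⟨Y, hY, hm⟩ := zorn_le_nonempty₀ {Y : Submodule A M | Disjoint X Y}
    (fun c hc hch y hy => ⟨sSup c, by
      have := hch.directedOn.disjoint_sSup_right (a := X)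
      exact this.2 fun b hb => hc hb, fun z hz => le_sSup hz⟩) Y₀ h
  exact ⟨Y, hY, hm.1, fun Z hZ hd => le_antisymm (hm.2 hd hZ) hZ⟩

/-- Every submodule of an injective module is essential in some direct summand. -/
theorem Injective.exists_essential_summand [Module.Injective A M] (X : Submodule A M) :
    ∃ Z, X ≤ Z ∧ IsDirectSummand Z ∧ ∀ W ≤ Z, Disjoint X W → W = ⊥ := by
  obtain ⟨Y, -, hXY, hY⟩ := exists_maximal_disjoint X ⊥ disjoint_bot_right
  obtain ⟨Z, hXZ, hYZ, hZ⟩ := exists_maximal_disjoint Y X hXY.symm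
  obtain ⟨φ, hφZ, hφY⟩ := Injective.exists_extension_vanishing hYZ.symm Z.subtype
  have hφX : ∀ x ∈ X, φ x = x := fun x hx => hφZ ⟨x, hXZ hx⟩
  -- `φ` fixes `X`, so the preimage of `Y` misses `X` and maximality of `Y` applies. Then the range
  -- of `φ` misses `Y`, and maximality of `Z` makes `φ` a projection onto `Z`.
  have hcomap : Y.comap φ = Y := by
    refine hY _ (fun y hy => by simp [hφY y hy]) (Submodule.disjoint_def.2 fun x hx hx' => ?_)
    exact Submodule.disjoint_def.1 hXY x hx (by simpa [hφX x hx] using hx')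
  have hrange : LinearMap.range φ = Z := by
    refine hZ _ (fun z hz => ⟨z, hφZ ⟨z, hz⟩⟩) (Submodule.disjoint_def.2 ?_)
    rintro _ hx ⟨p, rfl⟩
    exact hφY p (hcomap ▸ hx)
  refine ⟨Z, hXZ, isDirectSummand_iff_exists_projection.2
    ⟨φ, fun x => hrange ▸ ⟨x, rfl⟩, fun x hx => hφZ ⟨x, hx⟩⟩, fun W hWZ hW => ?_⟩
  have hsup : Y ⊔ W = Y := by
    refine hY _ le_sup_left (Submodule.disjoint_def.2 fun x hx hx' => ?_)
    obtain ⟨y, hy, w, hw, rfl⟩ := Submodule.mem_sup.1 hx'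
    have hy0 : y = 0 := by
      refine Submodule.disjoint_def.1 hYZ y hy ?_
      simpa using Z.sub_mem (hXZ hx) (hWZ hw)
    subst hy0
    simp only [zero_add] at hx ⊢
    exact Submodule.disjoint_def.1 hW w hx hw
  have hWY : W ≤ Y := hsup ▸ le_sup_right
  exact eq_bot_iff.2 fun w hw => Submodule.disjoint_def.1 hYZ w (hWY hw) (hWZ hw)

theorem exists_injective_embedding (M : Type u) [AddCommGroup M] [Module A M] :
    ∃ (E : Type u) (_ : AddCommGroup E) (_ : Module A E) (i : M →ₗ[A] E),
      Module.Injective A E ∧ Function.Injective i := by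
  let J := CategoryTheory.Injective.under (ModuleCat.of A M)
  let f : ModuleCat.of A M ⟶ J := CategoryTheory.Injective.ι _
  refine ⟨J, inferInstance, inferInstance, f.hom, ?_, ?_⟩
  · have hJ : CategoryTheory.Injective J := CategoryTheory.Injective.injective_under _
    exact (Module.injective_iff_injective_object A J).2 hJ
  · exact (ModuleCat.mono_iff_injective f).1 inferInstance

/-- Every finitely generated module is semisimple or contains a nonzero injective submodule. -/
def FiniteSemisimpleOrInjective (A : Type u) [Ring A] : Prop :=
  ∀ (M : Type u) [AddCommGroup M] [Module A M], Module.Finite A M →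
    IsSemisimpleModule A M ∨ ∃ D : Submodule A M, D ≠ ⊥ ∧ Module.Injective A D

/-- If the socle is proper, it lies in a maximal submodule `K`, which cannot be a summand: a
complement would be simple, hence inside `K`. Embed `M` in an injective `E` and test almost
projectivity of `M ⧸ K` on `M ⧸ K → E ⧸ K`. A lift would split `K` off `M`; otherwise a nonzero
summand of `E`, which is injective, lies inside `M`. -/
theorem finiteSemisimpleOrInjective_of_simple_isAlmostProjective
    (h : ∀ (M : Type u) [AddCommGroup M] [Module A M], IsSimpleModule A M →
      IsAlmostProjective A M) : FiniteSemisimpleOrInjective A := by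
  intro M _ _ hfin
  by_contra! hcon
  obtain ⟨hss, hinj⟩ := hcon
  have hsoc : sSup {S : Submodule A M | IsSimpleModule A S} ≠ ⊤ := fun htop =>
    hss (IsSemisimpleModule.of_sSup_simples_eq_top htop)
  obtain ⟨K, hK, hKs⟩ := (eq_top_or_exists_le_coatom _).resolve_left hsoc
  have hKnot : ¬ IsDirectSummand K := by
    rintro ⟨C, hC⟩
    have hCs : IsSimpleModule A C := isSimpleModule_iff_isAtom.2 (hC.symm.isAtom_iff_isCoatom.2 hK)
    have : C ≤ K := (le_sSup (show C ∈ {S : Submodule A M | IsSimpleModule A S} from hCs)).trans hKs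
    exact hK.1 (by simpa [sup_eq_left.2 this] using hC.sup_eq_top)
  obtain ⟨E, _, _, i, hE, hi⟩ := exists_injective_embedding (A := A) M
  have hsimple : IsSimpleModule A (M ⧸ K) := isSimpleModule_iff_isCoatom.2 hK
  let f : (M ⧸ K) →ₗ[A] E ⧸ K.map i := K.mapQ (K.map i) i (Submodule.le_comap_map i K)
  have hfr : ∀ (e : E) (x : M ⧸ K), (K.map i).mkQ e = f x → ∃ m, i m = e ∧ K.mkQ m = x := by
    intro e x he
    obtain ⟨m, rfl⟩ := K.mkQ_surjective x
    have he' : (K.map i).mkQ e = (K.map i).mkQ (i m) := he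
    rw [← sub_eq_zero, ← map_sub, ← LinearMap.mem_ker, Submodule.ker_mkQ] at he'
    obtain ⟨k, hk, hk'⟩ := he'
    refine ⟨m + k, by rw [map_add, hk']; abel, ?_⟩
    have : K.mkQ k = 0 := by simpa using hk
    rw [map_add, this, add_zero]
  rcases h (M ⧸ K) hsimple E (K.map i) f with ⟨g, hg⟩ | ⟨N', hN', hsum, g, hg⟩
  · apply hKnot
    have hmem : ∀ x, ∃ m, i m = g x ∧ K.mkQ m = x := fun x =>
      hfr (g x) x (LinearMap.congr_fun hg x).symm
    refine ⟨(LinearMap.range g).comap i, Submodule.disjoint_def.2 ?_, ?_⟩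
    · rintro m hm ⟨x, hx⟩
      obtain ⟨m', hm', rfl⟩ := hmem x
      obtain rfl : m' = m := hi (hm'.trans hx)
      have h0 : K.mkQ m' = 0 := by simpa using hm
      rw [h0, map_zero] at hx
      exact hi (by rw [← hx, map_zero])
    · rw [codisjoint_iff, eq_top_iff]
      intro m _
      obtain ⟨m', hm', hmm⟩ := hmem (K.mkQ m)
      refine Submodule.mem_sup.2 ⟨m - m', ?_, m', ⟨_, hm'.symm⟩, by abel⟩
      rw [← K.ker_mkQ, LinearMap.mem_ker, map_sub, hmm, sub_self]
  · have hle : N' ≤ LinearMap.range i := by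
      intro e he
      obtain ⟨m, hm, -⟩ := hfr e (g ⟨e, he⟩) (LinearMap.congr_fun hg ⟨e, he⟩)
      exact ⟨m, hm⟩
    have hN'inj : Module.Injective A N' := Injective.of_isDirectSummand hsum
    obtain ⟨D, hD, hDinj⟩ := Injective.exists_submodule_of_le_range hi hle hN'
    exact hinj D hD hDinj

end Generalities

/-! ### The consequence of condition 1) -/

section AllI0

variable {A : Type u} [Ring A] {M : Type u} [AddCommGroup M] [Module A M]

/-- Take `X` without a complement and add a `Y` maximal among the submodules disjoint from `X`. -/
theorem exists_proper_essential_of_not_isSemisimpleModule (h : ¬ IsSemisimpleModule A M) :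
    ∃ K : Submodule A M, K ≠ ⊤ ∧ ∀ W, Disjoint K W → W = ⊥ := by
  have h' : ¬ ∀ X : Submodule A M, ∃ Y, IsCompl X Y := fun hc => by
    have : ComplementedLattice (Submodule A M) := ⟨hc⟩
    exact h ⟨⟩
  push Not at h'
  obtain ⟨X, hX⟩ := h'
  obtain ⟨Y, -, hXY, hY⟩ := exists_maximal_disjoint X ⊥ disjoint_bot_right
  refine ⟨X ⊔ Y, fun htop => hX Y ⟨hXY, codisjoint_iff.2 htop⟩, fun W hW => ?_⟩
  have hsup : Y ⊔ W = Y := hY _ le_sup_left (hXY.disjoint_sup_right_of_disjoint_sup_left hW)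
  exact eq_bot_iff.2 ((le_inf ((hsup ▸ le_sup_right : W ≤ Y).trans le_sup_right) le_rfl).trans
    hW.le_bot)

/-- If a nonzero element of a direct summand `D` lies in an injective submodule, then
`D` contains a nonzero injective submodule. -/
theorem exists_injective_le_of_mem_summand {W : Type u} [AddCommGroup W] [Module A W]
    {D Q : Submodule A W} (hD : IsDirectSummand D) [Module.Injective A Q] {w : W} (hwD : w ∈ D)
    (hwQ : w ∈ Q) (hw : w ≠ 0) :
    ∃ D' ≤ D, D' ≠ ⊥ ∧ Module.Injective A D' := by
  obtain ⟨r, hr⟩ := hD.exists_retraction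
  obtain ⟨H, hwH, hH, hess⟩ :=
    Injective.exists_essential_summand (Submodule.span A {(⟨w, hwQ⟩ : Q)})
  have hwH' : (⟨w, hwQ⟩ : Q) ∈ H := hwH (Submodule.mem_span_singleton_self _)
  let k : H →ₗ[A] W := D.subtype ∘ₗ r ∘ₗ Q.subtype ∘ₗ H.subtype
  have hHinj : Module.Injective A H := Injective.of_isDirectSummand hH
  have hk : Function.Injective k := by
    -- The retraction onto `D` fixes `w`, so it is injective on the span of `w`, and by essentiality
    -- on all of `H`.
    have hbot := hess ((LinearMap.ker (r ∘ₗ Q.subtype)) ⊓ H) inf_le_right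
      (Submodule.disjoint_def.2 fun x hx hx' => by
        obtain ⟨a, rfl⟩ := Submodule.mem_span_singleton.1 hx
        have hk : r (a • w) = 0 := by simpa using hx'.1
        have hak := hr ⟨a • w, D.smul_mem a hwD⟩
        simp only [hk] at hak
        exact Subtype.ext (congrArg Subtype.val hak).symm)
    rw [← LinearMap.ker_eq_bot, eq_bot_iff]
    intro x hx
    have hx0 : (x : Q) ∈ LinearMap.ker (r ∘ₗ Q.subtype) ⊓ H := ⟨Subtype.ext hx, x.2⟩
    rw [hbot, Submodule.mem_bot] at hx0
    exact Subtype.ext hx0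
  refine ⟨LinearMap.range k, ?_, fun h0 => ?_,
    Injective.of_linearEquiv (LinearEquiv.ofInjective k hk)⟩
  · rintro _ ⟨x, rfl⟩
    exact (r _).2
  · have hz : (⟨⟨w, hwQ⟩, hwH'⟩ : H) = 0 := hk (by simp [LinearMap.range_eq_bot.1 h0])
    exact hw (congrArg (fun x : H => ((x : Q) : W)) hz)

/-- Let `K` be proper and essential. `M` embeds in the product of injective modules containing the
`M ⧸ F`, for `F ≤ K` finitely generated. Modulo the families `Z` that vanish for all large `F`,
exactly the elements of `K` die. Hence `M` is not small in `W = Z + M`, and it contains a nonzero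
summand of `W`, which must meet `Z` because `K` is essential. Each element of `Z` lies in an
injective subproduct inside `Z`. -/
theorem isSemisimpleModule_or_exists_injective_of_isI0Module
    (h : ∀ (M : Type u) [AddCommGroup M] [Module A M], IsI0Module A M)
    (M : Type u) [AddCommGroup M] [Module A M] :
    IsSemisimpleModule A M ∨ ∃ D : Submodule A M, D ≠ ⊥ ∧ Module.Injective A D := by
  by_contra! hcon
  obtain ⟨hss, hinj⟩ := hcon
  obtain ⟨K, hKtop, hK⟩ := exists_proper_essential_of_not_isSemisimpleModule hss
  let Λ := {F : Submodule A M // F.FG ∧ F ≤ K}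
  choose E _ _ i hE hi using fun F : Λ => exists_injective_embedding (A := A) (M ⧸ F.1)
  let y : M →ₗ[A] Π F, E F := LinearMap.pi fun F => i F ∘ₗ F.1.mkQ
  have hy_zero : ∀ m F, y m F = 0 ↔ m ∈ F.1 := fun m F => by
    change i F (F.1.mkQ m) = 0 ↔ _
    rw [map_eq_zero_iff _ (hi F), ← LinearMap.mem_ker, Submodule.ker_mkQ]
  have hy : Function.Injective y := by
    rw [← LinearMap.ker_eq_bot, eq_bot_iff]
    intro m hm
    exact (hy_zero m ⟨⊥, Submodule.fg_bot, bot_le⟩).1 (congrFun hm _)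
  let Z : Submodule A (Π F, E F) :=
    { carrier := {w | ∃ F₀ : Λ, ∀ F, F₀ ≤ F → w F = 0}
      add_mem' := by
        rintro a b ⟨F, hF⟩ ⟨F', hF'⟩
        refine ⟨⟨F.1 ⊔ F'.1, F.2.1.sup F'.2.1, sup_le F.2.2 F'.2.2⟩, fun G hG => ?_⟩
        simp [hF G (le_trans (show F.1 ≤ _ from le_sup_left) hG),
          hF' G (le_trans (show F'.1 ≤ _ from le_sup_right) hG)]
      zero_mem' := ⟨⟨⊥, Submodule.fg_bot, bot_le⟩, fun _ _ => rfl⟩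
      smul_mem' := by
        rintro c a ⟨F, hF⟩
        exact ⟨F, fun G hG => by simp [hF G hG]⟩ }
  let W := Z ⊔ LinearMap.range y
  let y' : M →ₗ[A] W := y.codRestrict W fun m => Submodule.mem_sup_right ⟨m, rfl⟩
  let X : Submodule A W := Z.comap W.subtype
  have hsmall : ¬ IsSmallSubmodule (LinearMap.range y') := by
    intro hs
    have hX : X = ⊤ := by
      refine hs X (eq_top_iff.2 ?_)
      rintro ⟨w, hw⟩ -
      obtain ⟨z, hz, _, ⟨m, rfl⟩, rfl⟩ := Submodule.mem_sup.1 hw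
      exact Submodule.mem_sup.2 ⟨y' m, ⟨m, rfl⟩, ⟨z, Submodule.mem_sup_left hz⟩, hz,
        Subtype.ext (add_comm _ _)⟩
    refine hKtop (eq_top_iff.2 fun m _ => ?_)
    obtain ⟨F, hF⟩ : y' m ∈ X := hX ▸ Submodule.mem_top
    exact F.2.2 ((hy_zero m F).1 (hF F le_rfl))
  obtain ⟨D, hDle, hDne, hDsum⟩ := h W _ hsmall
  by_cases hDX : Disjoint D X
  · refine hDne (eq_bot_iff.2 ?_)
    have hbot : D.comap y' = ⊥ := by
      refine hK _ (Submodule.disjoint_def.2 fun m hm hm' => ?_)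
      have hmX : y' m ∈ X := ⟨⟨Submodule.span A {m}, Submodule.fg_span_singleton m, by
        simpa using hm⟩, fun F hF => (hy_zero m F).2 (hF (Submodule.mem_span_singleton_self m))⟩
      have h0 := Submodule.disjoint_def.1 hDX _ hm' hmX
      exact hy (by rw [map_zero]; exact congrArg Subtype.val h0)
    intro d hd
    obtain ⟨m, rfl⟩ := hDle hd
    have : m ∈ D.comap y' := hd
    rw [hbot, Submodule.mem_bot] at this
    simp [this]
  · rw [Submodule.disjoint_def] at hDX
    push Not at hDX
    obtain ⟨w, hwD, ⟨F₀, hF₀⟩, hw⟩ := hDX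
    classical
    let p : (Π F, E F) →ₗ[A] W :=
      LinearMap.codRestrict W
        (LinearMap.pi fun F => if F₀ ≤ F then 0 else LinearMap.proj F) fun x =>
          Submodule.mem_sup_left ⟨F₀, fun F hF => by simp [hF]⟩
    have hp : ∀ x, W.subtype (p x) = fun F => if F₀ ≤ F then 0 else x F := by
      intro x
      funext F
      change (if F₀ ≤ F then (0 : (Π F, E F) →ₗ[A] E F) else LinearMap.proj F) x = _
      split_ifs <;> rfl
    have hpp : ∀ q ∈ LinearMap.range p, p (W.subtype q) = q := by
      rintro _ ⟨x, rfl⟩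
      apply W.injective_subtype
      rw [hp, hp]
      funext F
      simp only
      split_ifs <;> rfl
    have hwp : w ∈ LinearMap.range p := by
      refine ⟨W.subtype w, W.injective_subtype ?_⟩
      rw [hp]
      funext F
      split_ifs with hF
      · exact (hF₀ F hF).symm
      · rfl
    have hpinj : Module.Injective A (LinearMap.range p) :=
      Injective.of_retract (W.subtype ∘ₗ (LinearMap.range p).subtype) p.rangeRestrict
        fun x => Subtype.ext (hpp x x.2)
    obtain ⟨D', hD', hne, hinj'⟩ := exists_injective_le_of_mem_summand hDsum hwD hwp hw
    obtain ⟨D₀, hD₀, hD₀inj⟩ := Injective.exists_submodule_of_le_range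
      (fun a b hab => hy (congrArg Subtype.val hab)) (hD'.trans hDle) hne
    exact hinj D₀ hD₀ hD₀inj

end AllI0

/-! ### Regular quasi-projective modules -/

section RegularModules

variable {A : Type u} [Ring A] {P : Type u} [AddCommGroup P] [Module A P]

/-- A module is regular if each of its finitely generated submodules is a direct summand. -/
def IsRegularModule (A : Type u) [Ring A] (P : Type u) [AddCommGroup P] [Module A P] : Prop :=
  ∀ N : Submodule A P, N.FG → IsDirectSummand N

/-- A module `P` is quasi-projective if homomorphisms from `P` to a quotient of `P` lift to
endomorphisms of `P`. -/
def IsQuasiProjective (A : Type u) [Ring A] (P : Type u) [AddCommGroup P] [Module A P] : Prop :=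
  ∀ (X : Submodule A P) (f : P →ₗ[A] P ⧸ X), ∃ g : P →ₗ[A] P, ∀ x, X.mkQ (g x) = f x

theorem IsRegularModule.submodule (hP : IsRegularModule A P) (N : Submodule A P) :
    IsRegularModule A N := by
  intro X hX
  obtain ⟨p, hp, hp'⟩ := isDirectSummand_iff_exists_projection.1 (hP _ (hX.map N.subtype))
  have hpN : ∀ x, p x ∈ N := fun x => Submodule.map_subtype_le N X (hp x)
  refine isDirectSummand_iff_exists_projection.2
    ⟨(p.codRestrict N hpN) ∘ₗ N.subtype, fun x => ?_, fun x hx => ?_⟩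
  · obtain ⟨z, hz, hz'⟩ := hp x
    have : z = (p.codRestrict N hpN) x := Subtype.ext hz'
    exact this ▸ hz
  · exact Subtype.ext (hp' x ⟨x, hx, rfl⟩)

theorem IsQuasiProjective.of_isDirectSummand (hP : IsQuasiProjective A P) {N : Submodule A P}
    (hN : IsDirectSummand N) : IsQuasiProjective A N := by
  intro X f
  obtain ⟨r, hr⟩ := hN.exists_retraction
  let j : N ⧸ X →ₗ[A] P ⧸ X.map N.subtype :=
    X.mapQ (X.map N.subtype) N.subtype (Submodule.le_comap_map _ _)
  obtain ⟨g, hg⟩ := hP (X.map N.subtype) (j ∘ₗ f ∘ₗ r)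
  refine ⟨r ∘ₗ g ∘ₗ N.subtype, fun x => ?_⟩
  obtain ⟨n, hn⟩ := X.mkQ_surjective (f x)
  have h1 : (X.map N.subtype).mkQ (g x) = (X.map N.subtype).mkQ n := by
    rw [hg]
    simp only [LinearMap.comp_apply, hr]
    rw [← hn]
    rfl
  rw [← sub_eq_zero, ← map_sub, ← LinearMap.mem_ker, Submodule.ker_mkQ] at h1
  obtain ⟨y, hy, hy'⟩ := h1
  have h2 : g x = ((y + n : N) : P) := by
    rw [Submodule.coe_add]
    exact (sub_eq_iff_eq_add.1 hy'.symm)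
  have h3 : X.mkQ y = 0 := by simpa using hy
  rw [← hn]
  simp only [LinearMap.comp_apply, Submodule.subtype_apply]
  rw [h2, hr, map_add, h3, zero_add]

/-- The restriction of an endomorphism to a finitely generated submodule of a regular
quasi-projective module splits onto its image. -/
theorem IsRegularModule.exists_section (hP : IsRegularModule A P) (hQ : IsQuasiProjective A P)
    {X : Submodule A P} (hX : X.FG) (h : P →ₗ[A] P) :
    ∃ s : P →ₗ[A] P, ∀ x ∈ X, s (h x) ∈ X ∧ h (s (h x)) = h x := by
  let hX' : X →ₗ[A] P := h ∘ₗ X.subtype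
  have hfg : (LinearMap.range hX').FG := by
    rw [LinearMap.range_comp, Submodule.range_subtype]
    exact hX.map h
  obtain ⟨r, hr⟩ := (hP _ hfg).exists_retraction
  let K : Submodule A P := (LinearMap.ker hX').map X.subtype
  let j : X ⧸ LinearMap.ker hX' →ₗ[A] P ⧸ K :=
    (LinearMap.ker hX').mapQ K X.subtype (Submodule.le_comap_map _ _)
  -- The inverse of `X ⧸ ker ≃ h(X)` is lifted. The lift satisfies `s (h x) ≡ x` modulo `K`, and `K`
  -- lies both in `X` and in the kernel of `h`.
  obtain ⟨s, hs⟩ := hQ K (j ∘ₗ hX'.quotKerEquivRange.symm.toLinearMap ∘ₗ r)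
  refine ⟨s, fun x hx => ?_⟩
  have h1 : K.mkQ (s (h x)) = K.mkQ x := by
    rw [hs]
    have : r (h x) = hX'.quotKerEquivRange ((LinearMap.ker hX').mkQ ⟨x, hx⟩) :=
      hr ⟨h x, ⟨⟨x, hx⟩, rfl⟩⟩
    simp only [LinearMap.comp_apply, this, LinearEquiv.coe_coe, LinearEquiv.symm_apply_apply]
    rfl
  rw [← sub_eq_zero, ← map_sub, ← LinearMap.mem_ker, Submodule.ker_mkQ] at h1
  obtain ⟨y, hy, hy'⟩ := h1
  have h2 : s (h x) = y + x := sub_eq_iff_eq_add.1 hy'.symm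
  have h3 : h y = 0 := hy
  rw [h2]
  exact ⟨X.add_mem y.2 hx, by rw [map_add, h3, zero_add]⟩

/-- With `q` a projection onto `Y`, the kernel of `1 - q` is `Y`. If `s` is a section of `1 - q` on
`X`, then `1 - s(1 - q)` maps `X` onto `X ⊓ Y`. -/
theorem IsRegularModule.fg_inf (hP : IsRegularModule A P) (hQ : IsQuasiProjective A P)
    {X Y : Submodule A P} (hX : X.FG) (hY : Y.FG) : (X ⊓ Y).FG := by
  obtain ⟨q, hq, hq'⟩ := isDirectSummand_iff_exists_projection.1 (hP Y hY)
  obtain ⟨s, hs⟩ := hP.exists_section hQ hX (LinearMap.id - q)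
  have hmem : ∀ x, (LinearMap.id - q : P →ₗ[A] P) x = 0 → x ∈ Y := fun x hx => by
    rw [LinearMap.sub_apply, LinearMap.id_apply, sub_eq_zero] at hx
    exact hx ▸ hq x
  have : X ⊓ Y = X.map (LinearMap.id - s ∘ₗ (LinearMap.id - q)) := by
    apply le_antisymm
    · rintro x ⟨hx, hxY⟩
      exact ⟨x, hx, by simp [hq' x hxY]⟩
    · rintro _ ⟨x, hx, rfl⟩
      refine ⟨X.sub_mem hx (hs x hx).1, hmem _ ?_⟩
      change (LinearMap.id - q : P →ₗ[A] P) (x - s ((LinearMap.id - q : P →ₗ[A] P) x)) = 0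
      rw [map_sub, (hs x hx).2, sub_self]
  rw [this]
  exact hX.map _

/-- Regular quasi-projective modules are nonsingular: an endomorphism with essential kernel
vanishes. -/
theorem IsRegularModule.eq_zero_of_essential_ker (hP : IsRegularModule A P)
    (hQ : IsQuasiProjective A P) (h : P →ₗ[A] P)
    (hh : ∀ W, Disjoint (LinearMap.ker h) W → W = ⊥) : h = 0 := by
  ext p
  obtain ⟨s, hs⟩ := hP.exists_section hQ (Submodule.fg_span_singleton p) h
  have hp := (hs p (Submodule.mem_span_singleton_self p)).2
  have hbot := hh (Submodule.span A {s (h p)}) (Submodule.disjoint_def.2 fun x hx hx' => by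
    obtain ⟨a, rfl⟩ := Submodule.mem_span_singleton.1 hx'
    have ha : a • h p = 0 := by
      rw [← hp, ← map_smul]
      exact hx
    rw [← map_smul, ha, map_zero])
  rw [Submodule.span_singleton_eq_bot] at hbot
  rw [← hp, hbot, map_zero, LinearMap.zero_apply]

/-- In a vanishing finite sum, the term of largest index `k` lies in `T k`, hence is zero. -/
theorem iSupIndep_of_disjoint_monotone {T Q : ℕ → Submodule A P} (hT : Monotone T)
    (hQT : ∀ k, Q k ≤ T (k + 1)) (hd : ∀ k, Disjoint (T k) (Q k)) : iSupIndep Q := by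
  classical
  apply iSupIndep_of_dfinsupp_lsum_injective
  rw [← LinearMap.ker_eq_bot, eq_bot_iff]
  intro v hv
  by_contra hne
  have hsupp : v.support.Nonempty := by
    rw [Finset.nonempty_iff_ne_empty]
    exact fun h => hne (DFinsupp.support_eq_empty.1 h)
  set k := v.support.max' hsupp with hk
  have hkmem : k ∈ v.support := Finset.max'_mem _ _
  have hsum : ∑ i ∈ v.support, (v i : P) = 0 := by
    have := LinearMap.mem_ker.1 hv
    rw [DFinsupp.lsum_apply_apply, DFinsupp.sumAddHom_apply] at this
    exact this
  rw [← Finset.add_sum_erase _ _ hkmem] at hsum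
  have hvk : (v k : P) ∈ T k := by
    rw [eq_neg_of_add_eq_zero_left hsum]
    refine (T k).neg_mem ((T k).sum_mem fun i hi => ?_)
    have hik : i < k := lt_of_le_of_ne (Finset.le_max' _ _ (Finset.mem_of_mem_erase hi))
      (Finset.ne_of_mem_erase hi)
    exact hT hik (hQT i (v i).2)
  exact (DFinsupp.mem_support_iff.1 hkmem)
    (Subtype.ext (Submodule.disjoint_def.1 (hd k) _ hvk (v k).2))

/-- In a regular module, a countably but not finitely generated submodule is the direct sum of a
sequence of nonzero finitely generated submodules. -/
theorem IsRegularModule.exists_iSupIndep (hP : IsRegularModule A P) {T : ℕ → Submodule A P}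
    (hT : Monotone T) (hfg : ∀ n, (T n).FG) (hsup : ¬ (⨆ n, T n).FG) :
    ∃ Q : ℕ → Submodule A P, iSupIndep Q ∧ (∀ k, (Q k).FG) ∧ (∀ k, Q k ≠ ⊥) ∧
      ⨆ k, Q k = ⨆ n, T n := by
  -- Prepending `⊥` makes the first slice equal to `T 0`.
  let T' : ℕ → Submodule A P := fun n => Nat.casesOn n ⊥ T
  have hT' : Monotone T' := monotone_nat_of_le_succ fun n => by
    cases n with
    | zero => exact bot_le
    | succ n => exact hT n.le_succ
  have hfg' : ∀ n, (T' n).FG := fun n => by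
    cases n with
    | zero => exact Submodule.fg_bot
    | succ n => exact hfg n
  have hT'sup : ⨆ n, T' n = ⨆ n, T n := by
    apply le_antisymm
    · refine iSup_le fun n => ?_
      cases n with
      | zero => exact bot_le
      | succ n => exact le_iSup T n
    · exact iSup_le fun n => le_iSup T' (n + 1)
  choose p hp hp' using fun k => isDirectSummand_iff_exists_projection.1 (hP (T' k) (hfg' k))
  let Q : ℕ → Submodule A P := fun k => (T' (k + 1)).map (LinearMap.id - p k)
  have hQT : ∀ k, Q k ≤ T' (k + 1) := by
    rintro k _ ⟨x, hx, rfl⟩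
    exact (T' (k + 1)).sub_mem hx (hT' k.le_succ (hp k x))
  have hd : ∀ k, Disjoint (T' k) (Q k) := by
    refine fun k => Submodule.disjoint_def.2 ?_
    rintro _ hx' ⟨x, hx, rfl⟩
    rw [← hp' k _ hx']
    simp [hp' k _ (hp k x)]
  have hind := iSupIndep_of_disjoint_monotone hT' hQT hd
  have hT'Q : ∀ n, T' n ≤ ⨆ k, Q k := by
    intro n
    induction n with
    | zero => exact bot_le
    | succ n ih =>
      intro x hx
      have h1 : x - p n x ∈ ⨆ k, Q k := le_iSup Q n ⟨x, hx, rfl⟩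
      simpa using Submodule.add_mem _ h1 (ih (hp n x))
  have hQsup : ⨆ k, Q k = ⨆ n, T n := by
    rw [← hT'sup]
    exact le_antisymm (iSup_le fun k => (hQT k).trans (le_iSup T' (k + 1))) (iSup_le hT'Q)
  have hQfg : ∀ k, (Q k).FG := fun k => (hfg' (k + 1)).map _
  have hinf : Infinite {k // Q k ≠ ⊥} := by
    by_contra hfin
    rw [not_infinite_iff_finite] at hfin
    apply hsup
    rw [← hQsup, ← iSup_ne_bot_subtype]
    exact Submodule.fg_iSup _ fun k => hQfg k
  let e : ℕ ≃o {k | Q k ≠ ⊥} := by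
    have : Infinite {k | Q k ≠ ⊥} := hinf
    classical
    exact Nat.Subtype.orderIsoOfNat _
  refine ⟨fun n => Q (e n), hind.comp (Subtype.val_injective.comp e.injective),
    fun k => hQfg _, fun k => (e k).2, ?_⟩
  rw [← hQsup, ← iSup_ne_bot_subtype Q]
  exact e.toEquiv.iSup_comp (g := fun k : {k // Q k ≠ ⊥} => Q k)

end RegularModules

/-! ### The diagonal argument -/

section Osofsky

variable {A : Type u} [Ring A] {P : Type u} [AddCommGroup P] [Module A P]

theorem Injective.exists_extension_of_iSupIndep [Module.Injective A P] {Q : ℕ → Submodule A P}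
    (hQ : iSupIndep Q) (C : Set ℕ) :
    ∃ θ : P →ₗ[A] P, (∀ k ∈ C, ∀ q ∈ Q k, θ q = q) ∧ ∀ k ∉ C, ∀ q ∈ Q k, θ q = 0 := by
  classical
  obtain ⟨θ, hθ⟩ := Module.Injective.out (DFinsupp.lsum ℕ fun k => (Q k).subtype)
    hQ.dfinsupp_lsum_injective
    (DFinsupp.lsum ℕ fun k => if k ∈ C then (Q k).subtype else 0)
  have key : ∀ k, ∀ q : Q k, θ q = (if k ∈ C then (Q k).subtype else 0) q := fun k q => by
    simpa using hθ (DFinsupp.single k q)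
  exact ⟨θ, fun k hk q hq => by simpa [hk] using key k ⟨q, hq⟩,
    fun k hk q hq => by simpa [hk] using key k ⟨q, hq⟩⟩

theorem exists_le_iSup_lt_of_fg {Q : ℕ → Submodule A P} {F : Submodule A P} (hF : F.FG)
    (hle : F ≤ ⨆ k, Q k) : ∃ n, F ≤ ⨆ k, ⨆ _ : k < n, Q k := by
  obtain ⟨s, hs⟩ := CompleteLattice.IsCompactElement.exists_finset_of_le_iSup
    (Submodule A P) ((Submodule.fg_iff_compact F).1 hF) Q hle
  refine ⟨s.sup id + 1, hs.trans (iSup₂_le fun k hk => ?_)⟩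
  exact le_iSup₂_of_le k (Nat.lt_succ_of_le (Finset.le_sup (f := id) hk)) le_rfl

theorem iSupIndep.disjoint_iSup_lt {Q : ℕ → Submodule A P} (hQ : iSupIndep Q) {n k : ℕ}
    (h : n ≤ k) : Disjoint (Q k) (⨆ j, ⨆ _ : j < n, Q j) :=
  (hQ k).mono_right (iSup₂_mono' fun j hj => ⟨j, by lia, le_rfl⟩)

/-- Let `I` be the direct sum of a sequence of nonzero finitely generated submodules, essential in
a finitely generated injective regular quasi-projective module `P`. Then `P / I` is neither
injective nor Noetherian. -/
theorem not_injective_quotient_of_iSupIndep [Module.Finite A P] [Module.Injective A P]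
    (hR : IsRegularModule A P) (hqp : IsQuasiProjective A P) {Q : ℕ → Submodule A P}
    (hind : iSupIndep Q) (hfg : ∀ k, (Q k).FG) (hne : ∀ k, Q k ≠ ⊥)
    (hess : ∀ W, Disjoint (⨆ k, Q k) W → W = ⊥) :
    ¬ IsNoetherian A (P ⧸ ⨆ k, Q k) ∧ ¬ Module.Injective A (P ⧸ ⨆ k, Q k) := by
  set I := ⨆ k, Q k with hI
  let T : ℕ → Submodule A P := fun n => ⨆ k, ⨆ _ : k < n, Q k
  have hT : Monotone T := fun m n hmn => iSup₂_mono' fun k hk => ⟨k, hk.trans_le hmn, le_rfl⟩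
  have hrange : ∀ h : P →ₗ[A] P, (∀ p, h p ∈ I) → ∃ n, ∀ p, h p ∈ T n := by
    intro h hh
    obtain ⟨n, hn⟩ := exists_le_iSup_lt_of_fg (Q := Q)
      (Module.Finite.iff_fg.1 (inferInstance : Module.Finite A (LinearMap.range h))) (by rintro _ ⟨p, rfl⟩; exact hh p)
    exact ⟨n, fun p => hn ⟨p, rfl⟩⟩
  have hQI : ∀ k, Q k ≤ I := le_iSup Q
  -- Nonsingularity: an endomorphism is determined by its values on the essential submodule `I`. All
  -- the identities between the maps `θ C` come from this.
  have hext : ∀ h h' : P →ₗ[A] P, (∀ k, ∀ q ∈ Q k, h q = h' q) → h = h' := by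
    intro h h' hh
    rw [← sub_eq_zero]
    refine hR.eq_zero_of_essential_ker hqp _ fun W hW => hess W (hW.mono_left ?_)
    exact iSup_le fun k q hq => by simp [hh k q hq]
  choose θ hθ hθ' using Injective.exists_extension_of_iSupIndep hind
  have hθI : ∀ C, I ≤ I.comap (θ C) := fun C => iSup_le fun k q hq => by
    by_cases hk : k ∈ C
    · simpa [hθ C k hk q hq] using hQI k hq
    · simp [hθ' C k hk q hq]
  -- The pairing function splits `ℕ` into infinitely many infinite blocks, giving orthogonal
  -- idempotents `θ (B j)`.
  let B : ℕ → Set ℕ := fun j => {k | k.unpair.1 = j}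
  have hθθ : ∀ j p, θ (B j) (θ (B j) p) = θ (B j) p := fun j => by
    refine fun p => LinearMap.congr_fun (hext (θ (B j) ∘ₗ θ (B j)) (θ (B j)) fun k q hq => ?_) p
    by_cases hk : k ∈ B j
    · simp [hθ _ k hk q hq]
    · simp [hθ' _ k hk q hq]
  have hθθ' : ∀ i j, i ≠ j → ∀ p, θ (B i) (θ (B j) p) = 0 := fun i j hij => by
    refine fun p => LinearMap.congr_fun (hext (θ (B i) ∘ₗ θ (B j)) 0 fun k q hq => ?_) p
    by_cases hk : k ∈ B j
    · have hk' : k ∉ B i := fun h => hij (h.symm.trans hk)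
      simp [hθ _ k hk q hq, hθ' _ k hk' q hq]
    · simp [hθ' _ k hk q hq]
  let ψ : ℕ → (P ⧸ I) →ₗ[A] P ⧸ I := fun j => I.mapQ I (θ (B j)) (hθI _)
  have hψ : ∀ j p, ψ j (I.mkQ p) = I.mkQ (θ (B j) p) := fun _ _ => rfl
  let U : ℕ → Submodule A (P ⧸ I) := fun j => LinearMap.range (ψ j)
  have hψU : ∀ j, ∀ x ∈ U j, ψ j x = x := by
    rintro j _ ⟨x, rfl⟩
    obtain ⟨p, rfl⟩ := I.mkQ_surjective x
    rw [hψ, hψ, hθθ]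
  have hψU' : ∀ i j, i ≠ j → ∀ x ∈ U j, ψ i x = 0 := by
    rintro i j hij _ ⟨x, rfl⟩
    obtain ⟨p, rfl⟩ := I.mkQ_surjective x
    rw [hψ, hψ, hθθ' i j hij, map_zero]
  constructor
  · intro hN
    have hUind : iSupIndep U := by
      refine fun i => Submodule.disjoint_def.2 fun x hx hx' => ?_
      have hle : ⨆ j, ⨆ _ : j ≠ i, U j ≤ LinearMap.ker (ψ i) :=
        iSup₂_le fun j hj y hy => hψU' i j hj.symm y hy
      rw [← hψU i x hx]
      exact hle hx'
    have hUne : ∀ j, U j ≠ ⊥ := by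
      intro j hj
      -- If `U j = 0`, the image of `θ (B j)` lies in `T n`, although it contains `Q k` for `k =
      -- Nat.pair j n ≥ n`.
      obtain ⟨n, hn⟩ := hrange (θ (B j)) fun p => by
        have : ψ j (I.mkQ p) ∈ U j := ⟨_, rfl⟩
        rw [hj, Submodule.mem_bot, hψ] at this
        simpa using this
      have hk : Nat.pair j n ∈ B j := by simp [B]
      refine hne (Nat.pair j n) (eq_bot_iff.2 fun q hq => ?_)
      refine Submodule.disjoint_def.1 (iSupIndep.disjoint_iSup_lt hind (Nat.right_le_pair j n))
        q hq ?_
      rw [← hθ _ _ hk q hq]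
      exact hn q
    have hfin := Submodule.finite_ne_bot_of_iSupIndep hUind
    simp only [hUne, ne_eq, not_false_eq_true] at hfin
    exact Set.infinite_univ hfin
  · intro hinj
    have hdisj : Disjoint (⨆ j, U j) (⨅ j, LinearMap.ker (ψ j)) := by
      refine Submodule.disjoint_def.2 fun x hx hx' => ?_
      have hsum : ∃ s : Finset ℕ, ∀ t, s ⊆ t → ∑ j ∈ t, ψ j x = x := by
        refine Submodule.iSup_induction U (motive := fun x => ∃ s : Finset ℕ, ∀ t, s ⊆ t →
          ∑ j ∈ t, ψ j x = x) hx ?_ ⟨∅, by simp⟩ ?_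
        · intro i y hy
          refine ⟨{i}, fun t ht => ?_⟩
          rw [Finset.sum_eq_single_of_mem i (by simpa using ht)
            fun j _ hj => hψU' j i hj y hy, hψU i y hy]
        · rintro y z ⟨s, hs⟩ ⟨s', hs'⟩
          refine ⟨s ∪ s', fun t ht => ?_⟩
          simp only [map_add, Finset.sum_add_distrib]
          rw [hs t (Finset.union_subset_left ht), hs' t (Finset.union_subset_right ht)]
      obtain ⟨s, hs⟩ := hsum
      rw [← hs s subset_rfl]
      exact Finset.sum_eq_zero fun j _ => (Submodule.mem_iInf _).1 hx' j
    -- `f` is the identity on every `U j` and kills the common kernel of the `ψ j`; `x` lifts it to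
    -- `P`.
    obtain ⟨f, hfU, hfV⟩ := Injective.exists_extension_vanishing hdisj (⨆ j, U j).subtype
    obtain ⟨x, hx⟩ := hqp I (f ∘ₗ I.mkQ)
    have hxU : ∀ j, ∃ n, ∀ p, x (θ (B j) p) - θ (B j) p ∈ T n := by
      intro j
      refine hrange ((x - LinearMap.id) ∘ₗ θ (B j)) fun p => ?_
      rw [← I.ker_mkQ, LinearMap.mem_ker]
      have hmem : I.mkQ (θ (B j) p) ∈ ⨆ j, U j := le_iSup U j ⟨I.mkQ p, rfl⟩
      have := hfU ⟨_, hmem⟩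
      simp only [LinearMap.comp_apply, LinearMap.sub_apply, map_sub, LinearMap.id_apply, hx]
      rw [sub_eq_zero]
      exact this
    choose n hn using hxU
    -- One index is picked from each block, large enough that `x` agrees with the identity on `Q (k
    -- j)` modulo `T (k j)`, which is disjoint from `Q (k j)`.
    let k : ℕ → ℕ := fun j => Nat.pair j (max (n j) j)
    have hkB : ∀ j, k j ∈ B j := fun j => by simp [B, k]
    have hkn : ∀ j, n j ≤ k j := fun j => (le_max_left _ _).trans (Nat.right_le_pair _ _)
    have hkj : ∀ j, j ≤ k j := fun j => Nat.left_le_pair _ _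
    choose q hqQ hq0 using fun j => Submodule.exists_mem_ne_zero_of_ne_bot (hne (k j))
    have hxq : ∀ j, x (q j) ∉ T j := by
      intro j hj
      refine hq0 j (Submodule.disjoint_def.1 (iSupIndep.disjoint_iSup_lt hind le_rfl) _ (hqQ j) ?_)
      have h1 := hn j (q j)
      rw [hθ _ _ (hkB j) _ (hqQ j)] at h1
      simpa using (T (k j)).sub_mem (hT (hkj j) hj) (hT (hkn j) h1)
    let C : Set ℕ := Set.range k
    -- Block `j` meets `C` only in `k j`, so `θ (B j) ∘ θ C` has image in `Q (k j)`. Modulo `I`, the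
    -- image of `θ C` is thus in the common kernel, so `x ∘ θ C` maps into some `T m`; this
    -- contradicts `hxq m`.
    have hC : ∀ j p, θ (B j) (θ C p) ∈ I := by
      intro j p
      obtain ⟨ρ, hρ, hρ'⟩ := isDirectSummand_iff_exists_projection.1 (hR _ (hfg (k j)))
      have : ρ ∘ₗ θ (B j) ∘ₗ θ C = θ (B j) ∘ₗ θ C := by
        refine hext _ _ fun m y hy => ?_
        by_cases hm : m ∈ C
        · obtain ⟨i, rfl⟩ := hm
          have hyC := hθ C (k i) ⟨i, rfl⟩ y hy
          by_cases hij : i = j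
          · subst hij
            simp [hyC, hθ _ _ (hkB i) y hy, hρ' y hy]
          · have hki : k i ∉ B j := fun h => hij ((hkB i).symm.trans h)
            simp [hyC, hθ' _ _ hki y hy]
        · simp [hθ' C m hm y hy]
      have h2 := LinearMap.congr_fun this p
      simp only [LinearMap.comp_apply] at h2
      rw [← h2]
      exact hQI _ (hρ _)
    obtain ⟨m, hm⟩ := hrange (x ∘ₗ θ C) fun p => by
      rw [← I.ker_mkQ, LinearMap.mem_ker, LinearMap.comp_apply, hx]
      refine hfV _ ((Submodule.mem_iInf _).2 fun j => ?_)
      rw [LinearMap.mem_ker, hψ, ← LinearMap.mem_ker, I.ker_mkQ]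
      exact hC j p
    apply hxq m
    have := hm (q m)
    rwa [LinearMap.comp_apply, hθ C (k m) ⟨m, rfl⟩ _ (hqQ m)] at this

end Osofsky

/-! ### Existence of simple submodules -/

section SimpleSubmodules

variable {A : Type u} [Ring A] {P : Type u} [AddCommGroup P] [Module A P]

theorem fg_comap_subtype {N X : Submodule A P} (h : (X ⊓ N).FG) : (X.comap N.subtype).FG := by
  refine Submodule.fg_of_fg_map_injective N.subtype N.injective_subtype ?_
  rwa [Submodule.map_comap_subtype, inf_comm]

theorem iSup_comap_subtype_of_monotone {T : ℕ → Submodule A P} (hT : Monotone T)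
    (N : Submodule A P) :
    ⨆ n, (T n).comap N.subtype = (⨆ n, T n).comap N.subtype := by
  ext x
  rw [Submodule.mem_iSup_of_directed _
      (directed_of_isDirected_le fun m n h => Submodule.comap_mono (hT h)),
    Submodule.mem_comap, Submodule.mem_iSup_of_directed _ (directed_of_isDirected_le hT)]
  rfl

theorem essential_comap_subtype {X N : Submodule A P} (h : ∀ W ≤ N, Disjoint X W → W = ⊥)
    (W : Submodule A N) (hW : Disjoint (X.comap N.subtype) W) : W = ⊥ := by
  have := h (W.map N.subtype) (Submodule.map_subtype_le N W) (Submodule.disjoint_def.2 (by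
    rintro _ hx ⟨w, hw, rfl⟩
    exact congrArg Subtype.val (Submodule.disjoint_def.1 hW w hx hw)))
  exact (Submodule.map_injective_of_injective N.injective_subtype)
    (this.trans (Submodule.map_bot _).symm)

theorem IsRegularModule.eq_top_of_fg_of_essential (hR : IsRegularModule A P) {X : Submodule A P}
    (hX : X.FG) (hess : ∀ W, Disjoint X W → W = ⊥) : X = ⊤ := by
  obtain ⟨C, hC⟩ := hR X hX
  have := hC.sup_eq_top
  rwa [hess C hC.disjoint, sup_bot_eq] at this

theorem not_injective_quotient_of_essential [Module.Finite A P] [Module.Injective A P]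
    (hR : IsRegularModule A P) (hqp : IsQuasiProjective A P) {T : ℕ → Submodule A P}
    (hT : Monotone T) (hfg : ∀ n, (T n).FG) (htop : ⨆ n, T n ≠ ⊤)
    (hess : ∀ W, Disjoint (⨆ n, T n) W → W = ⊥) :
    ¬ IsNoetherian A (P ⧸ ⨆ n, T n) ∧ ¬ Module.Injective A (P ⧸ ⨆ n, T n) := by
  obtain ⟨Q, hind, hQfg, hne, hsup⟩ := hR.exists_iSupIndep hT hfg
    fun h => htop (hR.eq_top_of_fg_of_essential h hess)
  rw [← hsup] at hess ⊢
  exact not_injective_quotient_of_iSupIndep hR hqp hind hQfg hne hess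

/-- A projection onto `D` lifts to an endomorphism `g` of `P`. Its range `B` is a summand, and `D`
is the quotient of `B` by the trace of the essential submodule, so the preceding result applies to
`B`. -/
theorem not_injective_submodule_quotient_of_essential [Module.Finite A P] [Module.Injective A P]
    (hR : IsRegularModule A P) (hqp : IsQuasiProjective A P) {T : ℕ → Submodule A P}
    (hT : Monotone T) (hfg : ∀ n, (T n).FG) (hess : ∀ W, Disjoint (⨆ n, T n) W → W = ⊥)
    {D : Submodule A (P ⧸ ⨆ n, T n)} (hD : D ≠ ⊥) : ¬ Module.Injective A D := by
  intro hDinj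
  let I := ⨆ n, T n
  obtain ⟨d, hd, hd'⟩ := isDirectSummand_iff_exists_projection.1
    (Injective.isDirectSummand (N := D))
  obtain ⟨g, hg⟩ := hqp I (d ∘ₗ I.mkQ)
  let B : Submodule A P := LinearMap.range g
  have hBfg : B.FG := Module.Finite.iff_fg.1 inferInstance
  have hBsum : IsDirectSummand B := hR B hBfg
  have hBfin : Module.Finite A B := Module.Finite.iff_fg.2 hBfg
  have hBinj : Module.Injective A B := Injective.of_isDirectSummand hBsum
  let φ : B →ₗ[A] D := (I.mkQ ∘ₗ B.subtype).codRestrict D (by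
    rintro ⟨_, p, rfl⟩
    change I.mkQ (g p) ∈ D
    rw [hg]
    exact hd _)
  have hφ : Function.Surjective φ := by
    rintro ⟨x, hx⟩
    obtain ⟨p, rfl⟩ := I.mkQ_surjective x
    refine ⟨⟨g p, p, rfl⟩, Subtype.ext ?_⟩
    change I.mkQ (g p) = _
    rw [hg]
    exact hd' _ hx
  have hker : LinearMap.ker φ = ⨆ n, (T n).comap B.subtype := by
    rw [iSup_comap_subtype_of_monotone hT, LinearMap.ker_codRestrict, LinearMap.ker_comp,
      Submodule.ker_mkQ]
  refine (not_injective_quotient_of_essential (hR.submodule B) (hqp.of_isDirectSummand hBsum)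
    (T := fun n => (T n).comap B.subtype) (fun m n h => Submodule.comap_mono (hT h))
    (fun n => fg_comap_subtype (hR.fg_inf hqp (hfg n) hBfg)) ?_ ?_).2 ?_
  · rw [← hker]
    intro htop
    apply hD
    rw [eq_bot_iff]
    intro x hx
    obtain ⟨b, hb⟩ := hφ ⟨x, hx⟩
    have : b ∈ LinearMap.ker φ := htop ▸ Submodule.mem_top
    rw [LinearMap.mem_ker, hb] at this
    exact congrArg Subtype.val this
  · rw [iSup_comap_subtype_of_monotone hT]
    exact essential_comap_subtype fun W _ hW => hess W hW
  · rw [← hker]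
    exact Injective.of_linearEquiv (φ.quotKerEquivOfSurjective hφ).symm

theorem exists_monotone_fg_of_not_isNoetherian (h : ¬ IsNoetherian A P) :
    ∃ T : ℕ → Submodule A P, Monotone T ∧ (∀ n, (T n).FG) ∧ ¬ (⨆ n, T n).FG := by
  have hwf : ¬ WellFoundedGT (Submodule A P) := fun hw => h (isNoetherian_iff'.2 hw)
  rw [WellFoundedGT, isWellFounded_iff, RelEmbedding.wellFounded_iff_isEmpty,
    not_isEmpty_iff] at hwf
  obtain ⟨f⟩ := hwf
  have hf : ∀ n, f n < f (n + 1) := fun n => f.map_rel_iff.2 n.lt_succ_self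
  have hfm : Monotone f := monotone_nat_of_le_succ fun n => (hf n).le
  choose x hx hx' using fun n => SetLike.exists_of_lt (hf n)
  let T : ℕ → Submodule A P := fun n => Submodule.span A (x '' Set.Iio n)
  have hT : Monotone T := fun m n hmn =>
    Submodule.span_mono (Set.image_mono (Set.Iio_subset_Iio hmn))
  have hTf : ∀ n, T n ≤ f n := fun n => Submodule.span_le.2 (by
    rintro _ ⟨k, hk, rfl⟩
    exact hfm (Nat.succ_le_of_lt hk) (hx k))
  refine ⟨T, hT, fun n => Submodule.fg_span ((Set.finite_Iio n).image x), fun hfg => ?_⟩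
  obtain ⟨n, hn⟩ := (hfg.stabilizes_of_iSup_eq ⟨T, hT⟩ rfl)
  refine hx' n (hTf n ?_)
  have : x n ∈ T (n + 1) := Submodule.subset_span ⟨n, Nat.lt_succ_self n, rfl⟩
  exact hn.le (le_iSup T (n + 1) this)

/-- A Noetherian regular module is semisimple. Otherwise a countably generated submodule that is not
finitely generated is essential in a summand `Z`, and the resulting quotient of `Z` violates `hA`.
-/
theorem IsRegularModule.exists_simple_of_injective (hA : FiniteSemisimpleOrInjective A)
    [Module.Finite A P] [Module.Injective A P] [Nontrivial P] (hR : IsRegularModule A P)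
    (hqp : IsQuasiProjective A P) : ∃ S : Submodule A P, IsSimpleModule A S := by
  by_cases hN : IsNoetherian A P
  · have : ComplementedLattice (Submodule A P) := ⟨fun X => hR X (IsNoetherian.noetherian X)⟩
    have : IsSemisimpleModule A P := ⟨⟩
    exact IsSemisimpleModule.exists_simple_submodule A P
  exfalso
  obtain ⟨T, hT, hfg, hsup⟩ := exists_monotone_fg_of_not_isNoetherian hN
  obtain ⟨Z, hTZ, hZ, hess⟩ := Injective.exists_essential_summand (⨆ n, T n)
  have hZfin : Module.Finite A Z := hZ.finite
  have hZinj : Module.Injective A Z := Injective.of_isDirectSummand hZ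
  let T' : ℕ → Submodule A Z := fun n => (T n).comap Z.subtype
  have hT' : Monotone T' := fun m n h => Submodule.comap_mono (hT h)
  have hfg' : ∀ n, (T' n).FG := fun n => fg_comap_subtype (by
    rw [inf_eq_left.2 ((le_iSup T n).trans hTZ)]
    exact hfg n)
  have hess' : ∀ W, Disjoint (⨆ n, T' n) W → W = ⊥ := by
    rw [iSup_comap_subtype_of_monotone hT]
    exact essential_comap_subtype hess
  have htop : ⨆ n, T' n ≠ ⊤ := by
    rw [iSup_comap_subtype_of_monotone hT]
    intro htop
    apply hsup
    rw [Submodule.comap_subtype_eq_top] at htop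
    rw [le_antisymm hTZ htop]
    exact Module.Finite.iff_fg.1 hZfin
  have hqp' := hqp.of_isDirectSummand hZ
  rcases hA (Z ⧸ ⨆ n, T' n) inferInstance with hss | ⟨D, hD, hDinj⟩
  · exact (not_injective_quotient_of_essential (hR.submodule Z) hqp' hT' hfg' htop hess').1
      inferInstance
  · exact not_injective_submodule_quotient_of_essential (hR.submodule Z) hqp' hT' hfg' hess' hD
      hDinj

theorem IsRegularModule.exists_simple (hA : FiniteSemisimpleOrInjective A)
    [Module.Finite A P] [Nontrivial P] (hR : IsRegularModule A P)
    (hqp : IsQuasiProjective A P) : ∃ S : Submodule A P, IsSimpleModule A S := by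
  rcases hA P inferInstance with hss | ⟨D, hD, hDinj⟩
  · exact IsSemisimpleModule.exists_simple_submodule A P
  · have hDsum : IsDirectSummand D := Injective.isDirectSummand
    have hDfin : Module.Finite A D := hDsum.finite
    have : Nontrivial D := (Submodule.nontrivial_iff_ne_bot).2 hD
    obtain ⟨S, hS⟩ := (hR.submodule D).exists_simple_of_injective hA
      (hqp.of_isDirectSummand hDsum)
    exact ⟨S.map D.subtype, IsSimpleModule.congr
      (Submodule.equivMapOfInjective D.subtype D.injective_subtype S).symm⟩

/-- Full invariance lets projections and lifts descend, so `P ⧸ X` is again regular and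
quasi-projective. -/
theorem exists_simple_quotient_of_fullyInvariant (hA : FiniteSemisimpleOrInjective A)
    [Module.Finite A P] [Module.Projective A P] (hR : IsRegularModule A P) {X : Submodule A P}
    (hX : X ≠ ⊤) (hinv : ∀ f : P →ₗ[A] P, X ≤ X.comap f) :
    ∃ S : Submodule A (P ⧸ X), IsSimpleModule A S := by
  have : Nontrivial (P ⧸ X) := Submodule.Quotient.nontrivial_iff.2 hX
  refine IsRegularModule.exists_simple hA (fun N hN => ?_) fun Y f => ?_
  · obtain ⟨N', hN'fg, rfl⟩ : ∃ N' : Submodule A P, N'.FG ∧ N'.map X.mkQ = N := by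
      obtain ⟨s, rfl⟩ := hN
      choose r hr using X.mkQ_surjective
      refine ⟨Submodule.span A (r '' s), Submodule.fg_span (s.finite_toSet.image r), ?_⟩
      rw [Submodule.map_span, ← Set.image_comp]
      congr 1
      simp [hr]
    obtain ⟨p, hp, hp'⟩ := isDirectSummand_iff_exists_projection.1 (hR N' hN'fg)
    refine isDirectSummand_iff_exists_projection.2 ⟨X.mapQ X p (hinv p), fun x => ?_, ?_⟩
    · obtain ⟨y, rfl⟩ := X.mkQ_surjective x
      exact ⟨p y, hp y, rfl⟩
    · rintro _ ⟨y, hy, rfl⟩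
      change X.mkQ (p y) = _
      rw [hp' y hy]
  · obtain ⟨g, hg⟩ := Module.projective_lifting_property (Y.mkQ ∘ₗ X.mkQ) (f ∘ₗ X.mkQ)
      (Y.mkQ_surjective.comp X.mkQ_surjective)
    refine ⟨X.mapQ X g (hinv g), fun x => ?_⟩
    obtain ⟨y, rfl⟩ := X.mkQ_surjective x
    exact LinearMap.congr_fun hg y

end SimpleSubmodules

/-! ### Injectivity of simple modules and the `V` property -/

section SimpleInjective

variable {A : Type u} [Ring A]

/-- A sequence of elements of `S` that approximates a nonextendable homomorphism from a left
ideal generates a non-Noetherian submodule of the countable power of `S`. -/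
theorem exists_not_isNoetherian_span_of_not_baer (hR : IsRegularModule A A) {S : Type u}
    [AddCommGroup S] [Module A S] (hS : ¬ Module.Baer A S) :
    ∃ z : ℕ → S, ¬ IsNoetherian A (Submodule.span A {z}) := by
  unfold Module.Baer at hS
  push Not at hS
  obtain ⟨I, g, hg⟩ := hS
  -- A finitely generated `F` is a summand of `A`, so `g` on `F` extends to `A` and is given by the
  -- image of `1`.
  have hfg : ∀ F : {F : Submodule A A // F.FG ∧ F ≤ I}, ∃ s : S, ∀ x, ∀ hx : x ∈ F.1,
      x • s = g ⟨x, F.2.2 hx⟩ := by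
    rintro ⟨F, hF, hFI⟩
    obtain ⟨r, hr⟩ := (hR F hF).exists_retraction
    refine ⟨g (Submodule.inclusion hFI (r 1)), fun x hx => ?_⟩
    rw [← map_smul, ← map_smul, ← map_smul, smul_eq_mul, mul_one, hr ⟨x, hx⟩]
    rfl
  choose s hs using hfg
  have hbad : ∀ s₀ : S, ∃ x : I, (x : A) • s₀ ≠ g x := fun s₀ => by
    obtain ⟨x, hx, hne⟩ := hg (LinearMap.toSpanSingleton A S s₀)
    exact ⟨⟨x, hx⟩, hne⟩
  choose b hb using hbad
  let next : {F : Submodule A A // F.FG ∧ F ≤ I} → {F : Submodule A A // F.FG ∧ F ≤ I} :=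
    fun F => ⟨F.1 ⊔ Submodule.span A {(b (s F) : A)}, F.2.1.sup (Submodule.fg_span_singleton _),
      sup_le F.2.2 (by simp)⟩
  let F : ℕ → {F : Submodule A A // F.FG ∧ F ≤ I} :=
    fun n => Nat.rec ⟨⊥, Submodule.fg_bot, bot_le⟩ (fun _ => next) n
  have hF : Monotone F := monotone_nat_of_le_succ fun n => (le_sup_left : (F n).1 ≤ _)
  have hbF : ∀ n, (b (s (F n)) : A) ∈ (F (n + 1)).1 := fun n =>
    Submodule.mem_sup_right (Submodule.mem_span_singleton_self _)
  let z : ℕ → S := fun n => s (F n)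
  refine ⟨z, fun hN => ?_⟩
  -- `W n` consists of the sequences constant from `n` on. The multiple `b (z n) • z` is in `W (n +
  -- 1)` but not in `W n`.
  let W : ℕ →o Submodule A (Submodule.span A {z}) :=
    { toFun := fun n =>
        { carrier := {c | ∀ m, n ≤ m → c.1 m = c.1 n}
          add_mem' := fun {a c} ha hc m hm => by simp [ha m hm, hc m hm]
          zero_mem' := fun m hm => rfl
          smul_mem' := fun r a ha m hm => by simp [ha m hm] }
      monotone' := fun n n' h c hc m hm => (hc m (h.trans hm)).trans (hc n' h).symm }
  obtain ⟨n, hn⟩ := monotone_stabilizes_iff_noetherian.2 hN W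
  let c : Submodule.span A {z} :=
    ⟨(b (z n) : A) • z, Submodule.smul_mem _ _ (Submodule.mem_span_singleton_self z)⟩
  have hc : ∀ m, n + 1 ≤ m → c.1 m = g (b (z n)) := fun m hm =>
    hs (F m) _ (hF hm (hbF n))
  have hcW : c ∈ W (n + 1) := fun m hm => (hc m hm).trans (hc (n + 1) le_rfl).symm
  rw [← hn (n + 1) n.le_succ] at hcW
  exact hb (z n) ((hcW (n + 1) n.le_succ).symm.trans (hc (n + 1) le_rfl))

/-- Let `X` be the common kernel of all maps `A → S`. A simple `U ≤ A ⧸ X` has a nonzero map to `S`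
induced from `A`. This lifts through a surjection `D → S`, and the lift kills `X` because `D` embeds
in a power of `S`. So `U ≃ S` factors through `D`. -/
theorem injective_of_injective_embedded_in_power (hA : FiniteSemisimpleOrInjective A)
    (hR : IsRegularModule A A) {ι : Type*} {S D : Type u} [AddCommGroup S] [Module A S]
    [IsSimpleModule A S] [AddCommGroup D] [Module A D] [Nontrivial D] [Module.Injective A D]
    (j : D →ₗ[A] ι → S) (hj : Function.Injective j) : Module.Injective A S := by
  obtain ⟨d, hd0⟩ := exists_ne (0 : D)
  let ε : ι → D →ₗ[A] S := fun i => LinearMap.proj i ∘ₗ j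
  obtain ⟨n, hn⟩ : ∃ n, ε n d ≠ 0 := by
    by_contra! h
    exact hd0 (hj (by rw [map_zero]; exact funext h))
  have hε : Function.Surjective (ε n) :=
    LinearMap.surjective_of_ne_zero fun h0 => hn (LinearMap.congr_fun h0 d)
  let X : Submodule A A := ⨅ f : A →ₗ[A] S, LinearMap.ker f
  have hX : ∀ x, x ∈ X ↔ ∀ f : A →ₗ[A] S, f x = 0 := fun x => by simp [X]
  have hXtop : X ≠ ⊤ := by
    intro htop
    have h1 : (1 : A) ∈ X := htop ▸ Submodule.mem_top
    have := (hX 1).1 h1 (LinearMap.toSpanSingleton A S (ε n d))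
    exact hn (by simpa using this)
  obtain ⟨U, hU⟩ := exists_simple_quotient_of_fullyInvariant hA hR hXtop
    fun f x hx => (hX _).2 fun h => (hX x).1 hx (h ∘ₗ f)
  have := IsSimpleModule.nontrivial A U
  obtain ⟨⟨u, hu⟩, hu0⟩ := exists_ne (0 : U)
  obtain ⟨a, rfl⟩ := X.mkQ_surjective u
  obtain ⟨f, hf⟩ : ∃ f : A →ₗ[A] S, f a ≠ 0 := by
    by_contra! h
    exact hu0 (Subtype.ext (by simpa using (hX a).2 h))
  obtain ⟨f', hf'⟩ := Module.projective_lifting_property (ε n) f hε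
  have hf'X : X ≤ LinearMap.ker f' := fun x hx => hj (by
    rw [map_zero]
    exact funext fun i => (hX x).1 hx (ε i ∘ₗ f'))
  let k : U →ₗ[A] D := X.liftQ f' hf'X ∘ₗ U.subtype
  have hk : Function.Bijective (ε n ∘ₗ k) := LinearMap.bijective_of_ne_zero fun h0 =>
    hf ((LinearMap.congr_fun hf' a).symm.trans (LinearMap.congr_fun h0 ⟨_, hu⟩))
  let e : U ≃ₗ[A] S := LinearEquiv.ofBijective _ hk
  exact Injective.of_retract (k ∘ₗ e.symm.toLinearMap) (ε n) fun x => e.apply_symm_apply x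

theorem injective_of_isSimpleModule (hA : FiniteSemisimpleOrInjective A)
    (hR : IsRegularModule A A) (S : Type u) [AddCommGroup S] [Module A S] [IsSimpleModule A S] :
    Module.Injective A S := by
  by_contra hinj
  obtain ⟨z, hz⟩ := exists_not_isNoetherian_span_of_not_baer hR (S := S) fun h => hinj h.injective
  rcases hA (Submodule.span A {z}) inferInstance with hss | ⟨D, hD, hDinj⟩
  · exact hz inferInstance
  · have : Nontrivial D := Submodule.nontrivial_iff_ne_bot.2 hD
    exact hinj (injective_of_injective_embedded_in_power hA hR (D := D)
      ((Submodule.span A {z}).subtype ∘ₗ D.subtype)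
      (Subtype.val_injective.comp Subtype.val_injective))

variable {G M : Type u} [AddCommGroup G] [Module A G] [AddCommGroup M] [Module A M]

/-- For `x ∉ N`, a simple quotient of the span of `x` in `G ⧸ N` extends to a map on `G`, whose
kernel is maximal, contains `N` and misses `x`. -/
theorem isVModule_of_injective_simple
    (h : ∀ (S : Type u) [AddCommGroup S] [Module A S], IsSimpleModule A S →
      Module.Injective A S) : IsVModule A G := by
  refine fun N _ => ⟨{K | IsCoatom K ∧ N ≤ K}, fun K hK => hK.1,
    le_antisymm (fun x hx => ?_) (le_sInf fun K hK => hK.2)⟩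
  by_contra hxN
  let L : Submodule A (G ⧸ N) := Submodule.span A {N.mkQ x}
  have hxL : N.mkQ x ∈ L := Submodule.mem_span_singleton_self _
  have hLnt : Nontrivial L := ⟨⟨⟨_, hxL⟩, 0, fun h0 => hxN (by
    simpa using congrArg Subtype.val h0)⟩⟩
  obtain ⟨m, hm, -⟩ := (eq_top_or_exists_le_coatom (⊥ : Submodule A L)).resolve_left bot_ne_top
  have hsimple : IsSimpleModule A (L ⧸ m) := isSimpleModule_iff_isCoatom.2 hm
  have hinj := h (L ⧸ m) hsimple
  obtain ⟨k, hk⟩ := Module.Injective.out L.subtype L.injective_subtype m.mkQ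
  let f : G →ₗ[A] L ⧸ m := k ∘ₗ N.mkQ
  have hfx : f x = m.mkQ ⟨_, hxL⟩ := hk ⟨_, hxL⟩
  have hfx0 : f x ≠ 0 := by
    intro h0
    rw [hfx, ← LinearMap.mem_ker, Submodule.ker_mkQ] at h0
    refine hm.1 (eq_top_iff.2 ?_)
    rintro ⟨y, hy⟩ -
    obtain ⟨a, rfl⟩ := Submodule.mem_span_singleton.1 hy
    exact m.smul_mem a h0
  have hf : Function.Surjective f := LinearMap.surjective_of_ne_zero fun h0 => hfx0 (by simp [h0])
  have hcoatom : IsCoatom (LinearMap.ker f) := LinearMap.isCoatom_ker_of_surjective hf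
  have hNf : N ≤ LinearMap.ker f := fun y hy => by
    have : N.mkQ y = 0 := by simpa using hy
    rw [LinearMap.mem_ker, LinearMap.comp_apply, this, map_zero]
  exact hfx0 ((Submodule.mem_sInf.1 hx) _ ⟨hcoatom, hNf⟩)

/-- Baer's criterion: a maximal submodule `m` above `ker f` that misses some `i ∈ I` meets `I`
exactly in `ker f`, so `f` factors through `A → G ⧸ m`. -/
theorem IsVModule.injective_of_isSimpleModule (hG : IsVModule A G) (e : A ≃ₗ[A] G) (S : Type u)
    [AddCommGroup S] [Module A S] [IsSimpleModule A S] : Module.Injective A S := by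
  refine Module.Baer.injective fun I f => ?_
  by_cases hf0 : f = 0
  · exact ⟨0, fun x hx => by simp [hf0]⟩
  obtain ⟨i, hi⟩ : ∃ i, f i ≠ 0 := by
    by_contra! h
    exact hf0 (LinearMap.ext h)
  let K : Submodule A A := (LinearMap.ker f).map I.subtype
  have hiK : (i : A) ∉ K := by
    rintro ⟨j, hj, hji⟩
    exact hi (Subtype.ext hji ▸ hj)
  have hieK : e i ∉ K.map e.toLinearMap := by
    rintro ⟨j, hj, hji⟩
    exact hiK (e.injective hji ▸ hj)
  obtain ⟨s, hs, hsK⟩ := hG (K.map e.toLinearMap) fun htop => hieK (htop ▸ Submodule.mem_top)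
  rw [← hsK, Submodule.mem_sInf] at hieK
  push Not at hieK
  obtain ⟨m, hms, him⟩ := hieK
  have hKm : K.map e.toLinearMap ≤ m := hsK ▸ sInf_le hms
  have hsimple : IsSimpleModule A (G ⧸ m) := isSimpleModule_iff_isCoatom.2 (hs m hms)
  let φ : I →ₗ[A] G ⧸ m := m.mkQ ∘ₗ e.toLinearMap ∘ₗ I.subtype
  have hφi : φ i ≠ 0 := fun h0 => him (by simpa [φ] using h0)
  have hφ : Function.Surjective φ := LinearMap.surjective_of_ne_zero fun h0 => hφi (by simp [h0])
  have hle : LinearMap.ker f ≤ LinearMap.ker φ := fun x hx => by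
    have : e x ∈ m := hKm ⟨x, ⟨x, hx, rfl⟩, rfl⟩
    simpa [φ] using this
  have hfsurj : Function.Surjective f := LinearMap.surjective_of_ne_zero hf0
  have hfmax : IsCoatom (LinearMap.ker f) := LinearMap.isCoatom_ker_of_surjective hfsurj
  have hker : LinearMap.ker φ = LinearMap.ker f :=
    (hfmax.le_iff.1 hle).resolve_left fun h0 => hφi (by
      rw [← LinearMap.mem_ker, h0]
      exact Submodule.mem_top)
  let ψ : (G ⧸ m) →ₗ[A] S :=
    (LinearMap.ker φ).liftQ f hker.le ∘ₗ (φ.quotKerEquivOfSurjective hφ).symm.toLinearMap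
  refine ⟨ψ ∘ₗ m.mkQ ∘ₗ e.toLinearMap, fun x hx => ?_⟩
  change (LinearMap.ker φ).liftQ f hker.le ((φ.quotKerEquivOfSurjective hφ).symm (φ ⟨x, hx⟩)) = _
  have : (φ.quotKerEquivOfSurjective hφ).symm (φ ⟨x, hx⟩) = (LinearMap.ker φ).mkQ ⟨x, hx⟩ := by
    rw [LinearEquiv.symm_apply_eq]
    rfl
  rw [this]
  rfl

end SimpleInjective

/-! ### The Loewy series -/

section Loewy

variable {A : Type u} [Ring A] {G M N : Type u} [AddCommGroup G] [Module A G]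
  [AddCommGroup M] [Module A M] [AddCommGroup N] [Module A N]

theorem loewySeries_zero : loewySeries A G 0 = ⊥ :=
  Ordinal.limitRecOn_zero ..

theorem loewySeries_add_one (α : Ordinal.{u}) :
    loewySeries A G (α + 1) =
      (socle A (G ⧸ loewySeries A G α)).comap (loewySeries A G α).mkQ :=
  Ordinal.limitRecOn_add_one ..

theorem loewySeries_limit {α : Ordinal.{u}} (hα : Order.IsSuccLimit α) :
    loewySeries A G α = ⨆ γ : Set.Iio α, loewySeries A G γ :=
  Ordinal.limitRecOn_limit _ _ _ _ hα

theorem socle_le_comap (f : M →ₗ[A] N) : socle A M ≤ (socle A N).comap f := by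
  refine sSup_le fun S hS x hx => ?_
  have hS' : IsSimpleModule A S := hS
  rcases (f ∘ₗ S.subtype).injective_or_eq_zero with hinj | h0
  · have : IsSimpleModule A (LinearMap.range (f ∘ₗ S.subtype)) :=
      IsSimpleModule.congr (LinearEquiv.ofInjective _ hinj).symm
    exact le_sSup (show _ ∈ {S : Submodule A N | IsSimpleModule A S} from this) ⟨⟨x, hx⟩, rfl⟩
  · have : f x = 0 := LinearMap.congr_fun h0 ⟨x, hx⟩
    simp [this]

theorem loewySeries_le_comap (α : Ordinal.{u}) (f : G →ₗ[A] G) :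
    loewySeries A G α ≤ (loewySeries A G α).comap f := by
  induction α using Ordinal.limitRecOn with
  | zero => simp [loewySeries_zero]
  | add_one α ih =>
    rw [loewySeries_add_one]
    intro x hx
    exact socle_le_comap ((loewySeries A G α).mapQ (loewySeries A G α) f ih) hx
  | limit α hα ih =>
    rw [loewySeries_limit hα]
    exact iSup_le fun γ => (ih γ.1 γ.2).trans
      (Submodule.comap_mono (le_iSup (fun γ : Set.Iio α => loewySeries A G γ) γ))

theorem loewySeries_lt_of_lt
    (h : ∀ α : Ordinal.{u}, loewySeries A G α < loewySeries A G (α + 1)) {α β : Ordinal.{u}}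
    (hαβ : α < β) : loewySeries A G α < loewySeries A G β := by
  induction β using Ordinal.limitRecOn with
  | zero => exact absurd hαβ not_lt_zero
  | add_one β ih =>
    rcases (Order.lt_add_one_iff.1 hαβ).lt_or_eq with hlt | rfl
    · exact (ih hlt).trans (h β)
    · exact h α
  | limit β hβ ih =>
    refine (h α).trans_le ?_
    rw [loewySeries_limit hβ]
    exact le_iSup (fun γ : Set.Iio β => loewySeries A G γ) ⟨α + 1, hβ.add_one_lt hαβ⟩

theorem isSemiartinian_of_exists_simple
    (h : ∀ X : Submodule A G, X ≠ ⊤ → (∀ f : G →ₗ[A] G, X ≤ X.comap f) →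
      ∃ S : Submodule A (G ⧸ X), IsSimpleModule A S) : IsSemiartinian A G := by
  by_contra hcon
  have htop : ∀ α : Ordinal.{u}, loewySeries A G α ≠ ⊤ := fun α hα => hcon ⟨α, hα⟩
  have hlt : ∀ α : Ordinal.{u}, loewySeries A G α < loewySeries A G (α + 1) := by
    intro α
    obtain ⟨S, hS⟩ := h _ (htop α) (loewySeries_le_comap α)
    rw [loewySeries_add_one]
    refine lt_of_le_of_ne (fun x hx => ?_) fun heq => ?_
    · have : (loewySeries A G α).mkQ x = 0 := by simpa using hx
      rw [Submodule.mem_comap, this]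
      exact zero_mem _
    · have := IsSimpleModule.nontrivial A S
      obtain ⟨⟨s, hs⟩, hs0⟩ := exists_ne (0 : S)
      obtain ⟨x, rfl⟩ := (loewySeries A G α).mkQ_surjective s
      have hx : x ∈ (socle A (G ⧸ loewySeries A G α)).comap (loewySeries A G α).mkQ :=
        le_sSup (show S ∈ {S : Submodule A _ | IsSimpleModule A S} from hS) hs
      rw [← heq] at hx
      exact hs0 (Subtype.ext (by simpa using hx))
  have hmono : StrictMono (loewySeries A G) := fun α β hαβ => loewySeries_lt_of_lt hlt hαβ
  -- The ordinals do not inject into the type of submodules, which is small relative to them.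
  exact not_injective_of_ordinal _ hmono.injective

theorem IsSemiartinian.exists_simple_of_ne_zero (hG : IsSemiartinian A G) {f : G →ₗ[A] M}
    (hf : f ≠ 0) : ∃ S : Submodule A M, IsSimpleModule A S := by
  by_contra! hcon
  have hsoc : socle A M = ⊥ := by
    have : {S : Submodule A M | IsSimpleModule A S} = ∅ :=
      Set.eq_empty_of_forall_notMem hcon
    rw [socle, this, sSup_empty]
  obtain ⟨α, hα⟩ := hG
  have hker : ∀ α : Ordinal.{u}, loewySeries A G α ≤ LinearMap.ker f := by
    intro α
    induction α using Ordinal.limitRecOn with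
    | zero => simp [loewySeries_zero]
    | add_one α ih =>
      rw [loewySeries_add_one]
      intro x hx
      have := socle_le_comap ((loewySeries A G α).liftQ f ih) hx
      rw [hsoc] at this
      exact this
    | limit α hα ih =>
      rw [loewySeries_limit hα]
      exact iSup_le fun γ => ih γ.1 γ.2
  exact hf (LinearMap.ker_eq_top.1 (top_le_iff.1 (hα ▸ hker α)))

end Loewy

/-! ### Von Neumann regular rings and the equivalences -/

section RegularRing

theorem _root_.IsVonNeumannRegularRing.op {R : Type u} [Ring R] (hR : IsVonNeumannRegularRing R) :
    IsVonNeumannRegularRing Rᵐᵒᵖ := fun a => by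
  obtain ⟨b, hb⟩ := hR a.unop
  exact ⟨MulOpposite.op b, MulOpposite.unop_injective (by simpa [mul_assoc] using hb)⟩

variable {A : Type u} [Ring A] {G M : Type u} [AddCommGroup G] [Module A G] [AddCommGroup M]
  [Module A M]

theorem isRegularModule_of_cyclic (h : ∀ x : M, IsDirectSummand (Submodule.span A {x})) :
    IsRegularModule A M := by
  classical
  rintro _ ⟨s, rfl⟩
  induction s using Finset.induction_on with
  | empty => exact ⟨⊤, by simpa using isCompl_bot_top⟩
  | insert x s _ ih =>
    obtain ⟨p, hp, hp'⟩ := isDirectSummand_iff_exists_projection.1 ih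
    obtain ⟨q, hq, hq'⟩ := isDirectSummand_iff_exists_projection.1 (h (x - p x))
    have hs : Submodule.span A (s : Set M) ≤ Submodule.span A (insert x s : Finset M) :=
      Submodule.span_mono (by simp)
    have hx : x - p x ∈ Submodule.span A ((insert x s : Finset M) : Set M) :=
      Submodule.sub_mem _ (Submodule.subset_span (by simp)) (hs (hp x))
    -- `p` projects onto the span of `s`, and `q` onto the span of what `p` leaves of `x`.
    refine isDirectSummand_iff_exists_projection.2
      ⟨p + q ∘ₗ (LinearMap.id - p), fun y => ?_, fun y hy => ?_⟩
    · refine Submodule.add_mem _ (hs (hp y)) ?_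
      exact (Submodule.span_singleton_le_iff_mem _ _).2 hx (hq _)
    · rw [Finset.coe_insert, Submodule.mem_span_insert] at hy
      obtain ⟨a, z, hz, rfl⟩ := hy
      have hqx : q (x - p x) = x - p x := hq' _ (Submodule.mem_span_singleton_self _)
      rw [map_sub] at hqx
      simp only [LinearMap.add_apply, LinearMap.comp_apply, LinearMap.sub_apply,
        LinearMap.id_apply, map_add, map_smul, map_sub, hp' z hz]
      rw [hqx, sub_self, add_zero, add_sub_cancel]

theorem isRegularModule_self (hA : IsVonNeumannRegularRing A) : IsRegularModule A A := by
  refine isRegularModule_of_cyclic fun a => ?_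
  obtain ⟨b, hb⟩ := hA a
  refine isDirectSummand_iff_exists_projection.2
    ⟨LinearMap.toSpanSingleton A A (b * a), fun x => ?_, fun x hx => ?_⟩
  · exact Submodule.mem_span_singleton.2 ⟨x * b, by simp [mul_assoc]⟩
  · obtain ⟨c, rfl⟩ := Submodule.mem_span_singleton.1 hx
    simp [← mul_assoc, mul_assoc c, hb]

theorem IsRegularModule.of_linearEquiv (hG : IsRegularModule A G) (e : G ≃ₗ[A] M) :
    IsRegularModule A M := by
  intro N hN
  obtain ⟨p, hp, hp'⟩ := isDirectSummand_iff_exists_projection.1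
    (hG _ (hN.map e.symm.toLinearMap))
  refine isDirectSummand_iff_exists_projection.2
    ⟨e.toLinearMap ∘ₗ p ∘ₗ e.symm.toLinearMap, fun x => ?_, fun x hx => ?_⟩
  · obtain ⟨y, hy, hy'⟩ := hp (e.symm x)
    simp only [LinearMap.comp_apply, LinearEquiv.coe_coe] at hy' ⊢
    rw [← hy']
    simpa using hy
  · have := hp' (e.symm x) ⟨x, hx, rfl⟩
    simp [this]

theorem exists_summand_le (hs : IsSemiartinian A G) (hV : IsVModule A G) (e : A ≃ₗ[A] G)
    {N : Submodule A M} (hN : N ≠ ⊥) :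
    ∃ S ≤ N, S ≠ ⊥ ∧ IsDirectSummand S := by
  obtain ⟨x, hx, hx0⟩ := Submodule.exists_mem_ne_zero_of_ne_bot hN
  let f : G →ₗ[A] N := LinearMap.toSpanSingleton A N ⟨x, hx⟩ ∘ₗ e.symm.toLinearMap
  have hf : f ≠ 0 := fun h0 => hx0 (by
    have := LinearMap.congr_fun h0 (e 1)
    simpa [f] using this)
  obtain ⟨S, hS⟩ := hs.exists_simple_of_ne_zero hf
  have hS' : IsSimpleModule A (S.map N.subtype) := IsSimpleModule.congr
    (Submodule.equivMapOfInjective N.subtype N.injective_subtype S).symm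
  have := hV.injective_of_isSimpleModule e (S.map N.subtype)
  have := IsSimpleModule.nontrivial A (S.map N.subtype)
  exact ⟨S.map N.subtype, Submodule.map_subtype_le N S, Submodule.nontrivial_iff_ne_bot.1 this,
    Injective.isDirectSummand⟩

theorem isI0Module_of_isSemiartinian (hs : IsSemiartinian A G) (hV : IsVModule A G)
    (e : A ≃ₗ[A] G) : IsI0Module A M := fun N hN =>
  exists_summand_le hs hV e fun h0 => hN fun X hX => by simpa [h0] using hX

/-- If `K` is zero, the natural map is invertible. Otherwise a nonzero summand of `N` inside `K`
works with `h' = 0`. -/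
theorem isAlmostProjective_of_isSemiartinian (hs : IsSemiartinian A G) (hV : IsVModule A G)
    (e : A ≃ₗ[A] G) : IsAlmostProjective A M := by
  intro N _ _ K f
  by_cases hK : K = ⊥
  · refine Or.inl ⟨(K.quotEquivOfEqBot hK).toLinearMap ∘ₗ f, LinearMap.ext fun x => ?_⟩
    obtain ⟨y, hy⟩ := K.mkQ_surjective (f x)
    rw [LinearMap.comp_apply, LinearMap.comp_apply, ← hy]
    rfl
  · obtain ⟨S, hSK, hS0, hS⟩ := exists_summand_le hs hV e hK
    refine Or.inr ⟨S, hS0, hS, 0, LinearMap.ext fun x => ?_⟩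
    simpa using hSK x.2

theorem isSemiartinian_and_isVModule (hA : IsVonNeumannRegularRing A)
    (h : FiniteSemisimpleOrInjective A) (e : A ≃ₗ[A] G) :
    IsSemiartinian A G ∧ IsVModule A G := by
  have hR := isRegularModule_self hA
  have : Module.Finite A G := Module.Finite.equiv e
  have : Module.Projective A G := Module.Projective.of_equiv e
  refine ⟨isSemiartinian_of_exists_simple fun X hX hinv =>
    exists_simple_quotient_of_fullyInvariant h (hR.of_linearEquiv e) hX hinv,
    isVModule_of_injective_simple fun S _ _ hS => injective_of_isSimpleModule h hR S⟩

end RegularRing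

end Module

theorem theorem1p2 (R : Type u) [Ring R] (hR : IsVonNeumannRegularRing R) :
    List.TFAE [
      ∀ (M : Type u) [AddCommGroup M] [Module Rᵐᵒᵖ M], Module.IsI0Module Rᵐᵒᵖ M,
      IsRightSVRing R,
      ∀ (M : Type u) [AddCommGroup M] [Module Rᵐᵒᵖ M], Module.IsAlmostProjective Rᵐᵒᵖ M,
      ∀ (M : Type u) [AddCommGroup M] [Module Rᵐᵒᵖ M],
        IsSimpleModule Rᵐᵒᵖ M → Module.IsAlmostProjective Rᵐᵒᵖ M] := by
  -- This identifies the regular left `Rᵐᵒᵖ`-module with `R_R`, in terms of which condition 2) is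
  -- phrased.
  let e : Rᵐᵒᵖ ≃ₗ[Rᵐᵒᵖ] R :=
    { toFun := MulOpposite.unop
      invFun := MulOpposite.op
      map_add' := fun _ _ => rfl
      map_smul' := fun _ _ => rfl
      left_inv := fun _ => rfl
      right_inv := fun _ => rfl }
  tfae_have 1 → 2 := fun h => Module.isSemiartinian_and_isVModule hR.op
    (fun M _ _ _ => Module.isSemisimpleModule_or_exists_injective_of_isI0Module h M) e
  tfae_have 2 → 1 := fun h M _ _ => Module.isI0Module_of_isSemiartinian h.1 h.2 e
  tfae_have 2 → 3 := fun h M _ _ => Module.isAlmostProjective_of_isSemiartinian h.1 h.2 e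
  tfae_have 3 → 4 := fun h M _ _ _ => h M
  tfae_have 4 → 2 := fun h => Module.isSemiartinian_and_isVModule hR.op
    (Module.finiteSemisimpleOrInjective_of_simple_isAlmostProjective h) e
  tfae_finish
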